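/- Let $\mathcal{A}$ be a unital (complex) $C^*$-algebra and let $D, E, H : \mathcal{A} \to \mathcal{A}$ be linear maps such that $D$ is an $(E, I, I, H)$-derivation, i.e. $D(ab) = E(a)b + aH(b)$ for all $a, b \in \mathcal{A}$. Suppose that at least one of the following holds: (i) $D$, $E$ and $H$ are $*$-maps, i.e. $T(a^*) = T(a)^*$ for all $a \in \mathcal{A}$ and each $T \in \{D, E, H\}$; (ii) $\mathcal{A}$ is commutative. Then there is a derivation $\delta : \mathcal{A} \to \mathcal{A}$ (a linear map with $\delta(ab) = \delta(a)b + a\delta(b)$ for all $a, b$) such that $$D = \delta + L_{D(\mathbf{1})}, \qquad E = \delta + L_{E(\mathbf{1})}, \qquad H = \delta + L_{H(\mathbf{1})},$$ where $L_c(b) = cb$, and $D$, $E$, $H$ are generalized derivations associated with $\delta$, i.e. $T(ab) = T(a)b + a\delta(b)$ for all $a, b \in \mathcal{A}$ and each $T \in \{D, E, H\}$. Moreover, $D$, $E$ and $H$ are continuous. -/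

import Mathlib

section

variable {A B : Type*} [Ring A] [Algebra ℂ A] [Ring B] [Algebra ℂ B]

/-- The linear map `D` is an `(E, F, G, H)`-derivation:
`D (a b) = E a F b + G a H b` for all `a, b`. -/
def IsEFGHDerivation (D E F G H : A →ₗ[ℂ] B) : Prop :=
  ∀ a b : A, D (a * b) = E a * F b + G a * H b

/-- The linear map `δ` is a derivation of the (possibly noncommutative) algebra `A`:
`δ (a b) = δ a b + a δ b`. -/
def IsAlgDerivation (δ : A →ₗ[ℂ] A) : Prop :=
  ∀ a b : A, δ (a * b) = δ a * b + a * δ b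

/-- The linear map `T` is a generalized derivation associated with `d`:
`T (a b) = T a b + a d b`. -/
def IsGeneralizedDerivation (T d : A →ₗ[ℂ] A) : Prop :=
  IsEFGHDerivation T T LinearMap.id LinearMap.id d

/-- The linear map `T` is a `*`-map: `T (a*) = (T a)*`. -/
def IsStarMap [Star A] [Star B] (T : A →ₗ[ℂ] B) : Prop :=
  ∀ a : A, T (star a) = star (T a)

end

open Filter Topology

section DerivationContinuity

variable {A : Type*} [CStarAlgebra A]

/-! Putting `1` in either argument gives `D b = E 1 * b + H b` and `D a = E a + a * H 1`. Once `H 1`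
is central, `δ = H - L_{H 1}` is a derivation and `D`, `E`, `H` differ from it by left
multiplications, so continuity reduces to Sakai's theorem that derivations of a C⋆-algebra are
continuous. That theorem rests on dissipativity: `‖h‖ ≤ ‖h + δ h‖` for self-adjoint `h`, which
forces closability; the closed graph theorem finishes. -/

theorem IsAlgDerivation.map_one {δ : A →ₗ[ℂ] A} (hδ : IsAlgDerivation δ) : δ 1 = 0 := by
  simpa using hδ 1 1

theorem IsAlgDerivation.smul {δ : A →ₗ[ℂ] A} (hδ : IsAlgDerivation δ) (c : ℂ) :
    IsAlgDerivation (c • δ) := fun a b => by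
  simp [hδ a b, smul_add]

theorem IsAlgDerivation.add {δ η : A →ₗ[ℂ] A} (hδ : IsAlgDerivation δ)
    (hη : IsAlgDerivation η) : IsAlgDerivation (δ + η) := fun a b => by
  simp only [LinearMap.add_apply, hδ a b, hη a b, add_mul, mul_add]
  abel

/-- The conjugate `a ↦ (T a*)*` of a linear map. -/
noncomputable def starConjugate (T : A →ₗ[ℂ] A) : A →ₗ[ℂ] A where
  toFun a := star (T (star a))
  map_add' a b := by simp
  map_smul' c a := by simp

@[simp]
theorem starConjugate_apply (T : A →ₗ[ℂ] A) (a : A) :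
    starConjugate T a = star (T (star a)) := rfl

theorem IsAlgDerivation.starConjugate {δ : A →ₗ[ℂ] A} (hδ : IsAlgDerivation δ) :
    IsAlgDerivation (starConjugate δ) := fun a b => by
  simp [hδ (star b) (star a), add_comm]

/-- If the norm of a self-adjoint `h` is in its spectrum, then `‖h‖ - h` has a self-adjoint square
root `k` with self-adjoint approximate null vectors of norm one. -/
theorem exists_sqrt_norm_sub_and_approx_null {h : A} (hh : IsSelfAdjoint h)
    (hM : ‖h‖ ∈ spectrum ℝ h) :
    ∃ k : A, h = algebraMap ℝ A ‖h‖ - k * k ∧ ∀ ε : ℝ, 0 < ε →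
      ∃ y : A, IsSelfAdjoint y ∧ ‖y‖ = 1 ∧ ‖y * k‖ ≤ ε ∧ ‖k * y‖ ≤ ε := by
  have hle : ∀ x ∈ spectrum ℝ h, x ≤ ‖h‖ := fun x hx => by
    have : Nontrivial A := by
      by_contra hn
      rw [not_nontrivial_iff_subsingleton] at hn
      simp [spectrum.of_subsingleton] at hx
    exact (le_abs_self x).trans (spectrum.norm_le_norm_of_mem hx)
  refine ⟨cfc (fun x : ℝ => √(‖h‖ - x)) h, ?_, fun ε hε => ?_⟩
  · rw [← cfc_mul (fun x : ℝ => √(‖h‖ - x)) (fun x : ℝ => √(‖h‖ - x)) h,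
      cfc_congr (g := fun x : ℝ => ‖h‖ - x)
        (fun x hx => Real.mul_self_sqrt (sub_nonneg.2 (hle x hx))),
      cfc_sub (fun _ : ℝ => ‖h‖) (fun x : ℝ => x) h, cfc_const _ h, cfc_id' ℝ h]
    abel
  · have hbound : ∀ s : ℝ, 0 ≤ s → |max 0 (1 - s / ε) * s| ≤ ε := fun s hs => by
      rw [abs_of_nonneg (by positivity)]
      rcases le_total s ε with h1 | h1
      · have : max 0 (1 - s / ε) ≤ 1 := max_le zero_le_one (by
          have : 0 ≤ s / ε := by positivity
          linarith)
        nlinarith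
      · rw [max_eq_left (by rw [sub_nonpos, le_div_iff₀ hε]; linarith)]
        linarith
    -- A bump in `s = √(‖h‖ - x)`: it equals one at the spectral point `x = ‖h‖` and vanishes once
    -- `s ≥ ε`.
    refine ⟨cfc (fun x : ℝ => max 0 (1 - √(‖h‖ - x) / ε)) h, cfc_predicate _ h,
      le_antisymm ?_ ?_, ?_, ?_⟩
    · refine norm_cfc_le zero_le_one fun x _ => ?_
      rw [Real.norm_of_nonneg (le_max_left _ _)]
      have : 0 ≤ √(‖h‖ - x) / ε := by positivity
      exact max_le zero_le_one (by linarith)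
    · simpa using norm_apply_le_norm_cfc (fun x : ℝ => max 0 (1 - √(‖h‖ - x) / ε)) h hM
    · rw [← cfc_mul (fun x : ℝ => max 0 (1 - √(‖h‖ - x) / ε)) (fun x : ℝ => √(‖h‖ - x)) h]
      exact norm_cfc_le hε.le fun x _ => hbound _ (Real.sqrt_nonneg _)
    · rw [← cfc_mul (fun x : ℝ => √(‖h‖ - x)) (fun x : ℝ => max 0 (1 - √(‖h‖ - x) / ε)) h]
      refine norm_cfc_le hε.le fun x _ => ?_
      rw [mul_comm]
      exact hbound _ (Real.sqrt_nonneg _)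

/-- Since `h = ‖h‖ - k * k`, each term of `δ h` has `k` as an outer factor. Compressing by an
approximate null vector `y` of `k` makes `δ h` negligible and leaves nearly `‖h‖ • (y * y)`. -/
theorem IsAlgDerivation.norm_le_norm_add_apply_of_norm_mem_spectrum {δ : A →ₗ[ℂ] A}
    (hδ : IsAlgDerivation δ) {h : A} (hh : IsSelfAdjoint h) (hM : ‖h‖ ∈ spectrum ℝ h) :
    ‖h‖ ≤ ‖h + δ h‖ := by
  obtain ⟨k, hk, happrox⟩ := exists_sqrt_norm_sub_and_approx_null hh hM
  set M := ‖h‖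
  have hconst : δ (algebraMap ℝ A M) = 0 := by
    rw [IsScalarTower.algebraMap_apply ℝ ℂ A, Algebra.algebraMap_eq_smul_one, map_smul,
      hδ.map_one, smul_zero]
  have hδh : δ h = -(δ k * k + k * δ k) := by
    conv_lhs => rw [hk]
    rw [map_sub, hconst, hδ, zero_sub]
  have key : ∀ ε : ℝ, 0 < ε → M ≤ ‖h + δ h‖ + (ε * ε + 2 * ‖δ k‖ * ε) := fun ε hε => by
    obtain ⟨y, hy, hy1, hyk, hky⟩ := happrox ε hε
    have hsplit : M • (y * y) = y * (h + δ h) * y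
        + ((y * k) * (k * y) + (y * δ k * (k * y) + (y * k) * (δ k * y))) := by
      have h1 : h + δ h = M • (1 : A) - k * k - (δ k * k + k * δ k) := by
        rw [hδh, ← Algebra.algebraMap_eq_smul_one, ← hk, sub_eq_add_neg]
      rw [h1]
      simp only [mul_sub, sub_mul, mul_add, add_mul, mul_smul_comm, smul_mul_assoc, mul_one,
        mul_assoc]
      abel
    have hyy : ‖y * y‖ = 1 := by
      have := CStarRing.norm_star_mul_self (x := y)
      rw [hy.star_eq, hy1] at this
      simpa using this
    have hnorm : ‖M • (y * y)‖ = M := by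
      rw [norm_smul, hyy, mul_one, Real.norm_of_nonneg (norm_nonneg h)]
    have e1 : ‖y * (h + δ h) * y‖ ≤ ‖h + δ h‖ := by
      calc _ ≤ ‖y‖ * ‖h + δ h‖ * ‖y‖ := norm_mul₃_le
        _ = _ := by rw [hy1]; ring
    have e2 : ‖(y * k) * (k * y)‖ ≤ ε * ε := norm_mul_le_of_le hyk hky
    have e3 : ‖y * δ k * (k * y)‖ ≤ ‖δ k‖ * ε :=
      norm_mul_le_of_le ((norm_mul_le _ _).trans_eq (by rw [hy1, one_mul])) hky
    have e4 : ‖(y * k) * (δ k * y)‖ ≤ ε * ‖δ k‖ :=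
      norm_mul_le_of_le hyk ((norm_mul_le _ _).trans_eq (by rw [hy1, mul_one]))
    calc M = ‖M • (y * y)‖ := hnorm.symm
      _ ≤ ‖h + δ h‖ + (ε * ε + (‖δ k‖ * ε + ε * ‖δ k‖)) := by
        rw [hsplit]
        exact norm_add_le_of_le e1 (norm_add_le_of_le e2 (norm_add_le_of_le e3 e4))
      _ = _ := by ring
  have hlim : Tendsto (fun ε : ℝ => ‖h + δ h‖ + (ε * ε + 2 * ‖δ k‖ * ε)) (𝓝[>] 0)
      (𝓝 ‖h + δ h‖) := by
    have hc : Continuous fun ε : ℝ => ‖h + δ h‖ + (ε * ε + 2 * ‖δ k‖ * ε) := by fun_prop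
    simpa using (hc.tendsto 0).mono_left nhdsWithin_le_nhds
  exact ge_of_tendsto hlim (eventually_mem_nhdsWithin.mono fun ε hε => key ε hε)

/-- Derivations are conservative on self-adjoint elements. -/
theorem IsAlgDerivation.norm_le_norm_add_apply {δ : A →ₗ[ℂ] A} (hδ : IsAlgDerivation δ) {h : A}
    (hh : IsSelfAdjoint h) : ‖h‖ ≤ ‖h + δ h‖ := by
  rcases subsingleton_or_nontrivial A with hA | hA
  · simp [Subsingleton.elim h 0]
  rcases CStarAlgebra.norm_or_neg_norm_mem_spectrum hh with hM | hM
  · exact hδ.norm_le_norm_add_apply_of_norm_mem_spectrum hh hM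
  · have := hδ.norm_le_norm_add_apply_of_norm_mem_spectrum hh.neg
      (by rw [norm_neg, ← spectrum.neg_eq]; simpa using hM)
    rwa [map_neg, ← neg_add, norm_neg, norm_neg] at this

/-- A derivation is closable as a map of the self-adjoint part: the only self-adjoint limit of
`δ (u n)` along self-adjoint `u n → 0` is zero. -/
theorem IsAlgDerivation.eq_zero_of_tendsto_of_isSelfAdjoint {δ : A →ₗ[ℂ] A}
    (hδ : IsAlgDerivation δ) {u : ℕ → A} {a : A} (hu : ∀ n, IsSelfAdjoint (u n))
    (ha : IsSelfAdjoint a) (hu0 : Tendsto u atTop (𝓝 0))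
    (hδu : Tendsto (fun n => δ (u n)) atTop (𝓝 a)) : a = 0 := by
  -- Apply the norm inequality for `t • δ` to `-a + t⁻¹ • u n`: the scalings cancel on `u n`, so the
  -- limit `a` of `δ (u n)` cancels `-a`.
  have key : ∀ t : ℝ, 0 < t → ‖a‖ ≤ ‖(t : ℂ) • δ (-a)‖ := fun t ht => by
    have hstep : ∀ n, ‖-a + ((t⁻¹ : ℝ) : ℂ) • u n‖ ≤
        ‖-a + ((t⁻¹ : ℝ) : ℂ) • u n + ((t : ℂ) • δ (-a) + δ (u n))‖ := fun n => by
      have hsa : IsSelfAdjoint (-a + ((t⁻¹ : ℝ) : ℂ) • u n) :=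
        ha.neg.add (IsSelfAdjoint.smul (Complex.conj_ofReal _) (hu n))
      have := (hδ.smul (t : ℂ)).norm_le_norm_add_apply hsa
      have ht' : (t : ℂ) ≠ 0 := by exact_mod_cast ht.ne'
      have hδs : ((t : ℂ) • δ) (-a + ((t⁻¹ : ℝ) : ℂ) • u n) = (t : ℂ) • δ (-a) + δ (u n) := by
        rw [LinearMap.smul_apply, map_add, map_smul, smul_add, smul_smul, Complex.ofReal_inv,
          mul_inv_cancel₀ ht', one_smul]
      rwa [hδs] at this
    have h0 : Tendsto (fun n => -a + ((t⁻¹ : ℝ) : ℂ) • u n) atTop (𝓝 (-a)) := by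
      simpa using (hu0.const_smul ((t⁻¹ : ℝ) : ℂ)).const_add (-a)
    have h1 := (h0.add (hδu.const_add ((t : ℂ) • δ (-a)))).norm
    have h2 := le_of_tendsto_of_tendsto' h0.norm h1 hstep
    rwa [norm_neg, add_comm ((t : ℂ) • δ (-a)) a, neg_add_cancel_left] at h2
  have hlim : Tendsto (fun t : ℝ => ‖(t : ℂ) • δ (-a)‖) (𝓝[>] 0) (𝓝 0) := by
    have hc : Continuous fun t : ℝ => ‖(t : ℂ) • δ (-a)‖ := by fun_prop
    simpa using (hc.tendsto 0).mono_left nhdsWithin_le_nhds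
  exact norm_le_zero_iff.1
    (ge_of_tendsto hlim (eventually_mem_nhdsWithin.mono fun t ht => key t ht))

/-- A `*`-map respects real and imaginary parts, so closability on self-adjoint elements kills both
parts of the graph defect `y - δ x`. -/
theorem IsAlgDerivation.continuous_of_isStarMap {δ : A →ₗ[ℂ] A} (hδ : IsAlgDerivation δ)
    (hs : IsStarMap δ) : Continuous δ := by
  refine LinearMap.continuous_of_seq_closed_graph δ fun u x y hu hδu => ?_
  have hv : Tendsto (fun n => u n - x) atTop (𝓝 0) := by
    simpa using hu.sub_const x
  have hδv : Tendsto (fun n => δ (u n - x)) atTop (𝓝 (y - δ x)) := by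
    simpa using Tendsto.sub_const (f := fun n => δ (u n)) hδu (δ x)
  have hre : (y - δ x) + star (y - δ x) = 0 := by
    refine hδ.eq_zero_of_tendsto_of_isSelfAdjoint (fun n => IsSelfAdjoint.add_star_self (u n - x))
      (IsSelfAdjoint.add_star_self _) (by simpa using hv.add hv.star) ?_
    simpa only [map_add, hs _] using hδv.add hδv.star
  have him : Complex.I • ((y - δ x) - star (y - δ x)) = 0 := by
    have hsa : ∀ z : A, IsSelfAdjoint (Complex.I • (z - star z)) := fun z => by
      simp [isSelfAdjoint_iff, smul_sub, neg_add_eq_sub]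
    refine hδ.eq_zero_of_tendsto_of_isSelfAdjoint (fun n => hsa (u n - x)) (hsa _)
      (by simpa using (hv.sub hv.star).const_smul Complex.I) ?_
    simpa only [map_smul, map_sub δ (_ - _) (star _), hs _] using
      (hδv.sub hδv.star).const_smul Complex.I
  have him' := (smul_eq_zero.1 him).resolve_left Complex.I_ne_zero
  have h2 : (2 : ℂ) • (y - δ x) = 0 := by
    rw [two_smul]
    calc _ = ((y - δ x) + star (y - δ x)) + ((y - δ x) - star (y - δ x)) := by abel
      _ = 0 := by rw [hre, him', add_zero]
  exact sub_eq_zero.1 ((smul_eq_zero.1 h2).resolve_left two_ne_zero)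

/-- Every derivation of a unital C⋆-algebra is continuous. -/
theorem IsAlgDerivation.continuous {δ : A →ₗ[ℂ] A} (hδ : IsAlgDerivation δ) : Continuous δ := by
  have h1 : Continuous (δ + _root_.starConjugate δ) :=
    (hδ.add hδ.starConjugate).continuous_of_isStarMap fun a => by simp [add_comm]
  have h2 : Continuous (Complex.I • (δ + (-1 : ℂ) • _root_.starConjugate δ)) :=
    ((hδ.add (hδ.starConjugate.smul (-1))).smul Complex.I).continuous_of_isStarMap fun a => by
      simp [smul_add, add_comm]
  have h3 : (δ : A → A) = fun a => (2⁻¹ : ℂ) • ((δ + _root_.starConjugate δ) a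
      - Complex.I • (Complex.I • (δ + (-1 : ℂ) • _root_.starConjugate δ)) a) := by
    funext a
    simp only [LinearMap.add_apply, LinearMap.smul_apply, smul_smul, Complex.I_mul_I]
    module
  rw [h3]
  fun_prop

end DerivationContinuity

theorem mainTheorem4 {A : Type*} [CStarAlgebra A] (D E H : A →ₗ[ℂ] A)
    (hD : IsEFGHDerivation D E LinearMap.id LinearMap.id H)
    (hcase : (IsStarMap D ∧ IsStarMap E ∧ IsStarMap H) ∨ (∀ a b : A, a * b = b * a)) :
    (∃ δ : A →ₗ[ℂ] A, IsAlgDerivation δ ∧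
      D = δ + LinearMap.mulLeft ℂ (D 1) ∧
      E = δ + LinearMap.mulLeft ℂ (E 1) ∧
      H = δ + LinearMap.mulLeft ℂ (H 1) ∧
      IsGeneralizedDerivation D δ ∧ IsGeneralizedDerivation E δ ∧
      IsGeneralizedDerivation H δ) ∧
    Continuous D ∧ Continuous E ∧ Continuous H := by
  have hmul : ∀ a b, D (a * b) = E a * b + a * H b := hD
  have hDH : ∀ b, D b = E 1 * b + H b := fun b => by simpa using hmul 1 b
  have hDE : ∀ a, D a = E a + a * H 1 := fun a => by simpa using hmul a 1
  -- In the `*`-case, compare `D (star a)` with `star (D a)` through `hDE`.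
  have hcomm : ∀ a, H 1 * a = a * H 1 := by
    rcases hcase with ⟨hsD, hsE, hsH⟩ | hc
    · intro a
      have h1 : star (H 1) = H 1 := by rw [← hsH, star_one]
      have h2 := hDE (star a)
      rw [hsD, hsE, hDE a, star_add, star_mul, h1, add_right_inj] at h2
      simpa [h1] using congrArg star (h2 : H 1 * star a = star a * H 1).symm
    · exact fun a => hc _ _
  set δ : A →ₗ[ℂ] A := H - LinearMap.mulLeft ℂ (H 1) with hδdef
  have eH : H = δ + LinearMap.mulLeft ℂ (H 1) := by simp [hδdef]
  have hHa : ∀ a, H a = δ a + H 1 * a := fun a => by simp [hδdef]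
  have eD : D = δ + LinearMap.mulLeft ℂ (D 1) := by
    ext a
    simp only [LinearMap.add_apply, LinearMap.mulLeft_apply, hDH a, hDE 1, hHa a, one_mul, add_mul]
    abel
  have hDa : ∀ a, D a = δ a + D 1 * a := fun a => LinearMap.congr_fun eD a
  have eE : E = δ + LinearMap.mulLeft ℂ (E 1) := by
    ext a
    have h1 := hDE a
    rw [hDa a, hDE 1, one_mul, add_mul, hcomm a, ← add_assoc] at h1
    exact (add_right_cancel h1).symm
  have hEa : ∀ a, E a = δ a + E 1 * a := fun a => LinearMap.congr_fun eE a
  have hδ : IsAlgDerivation δ := fun a b => by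
    have h1 := hmul a b
    rw [hDa, hEa a, hHa b, hDE 1, one_mul, add_mul, add_mul, mul_add, ← mul_assoc a, ← hcomm a,
      mul_assoc, mul_assoc] at h1
    have h2 : δ (a * b) + (E 1 * (a * b) + H 1 * (a * b))
        = δ a * b + a * δ b + (E 1 * (a * b) + H 1 * (a * b)) := by
      rw [h1]
      abel
    exact add_right_cancel h2
  have hgen : ∀ T : A →ₗ[ℂ] A, T = δ + LinearMap.mulLeft ℂ (T 1) →
      IsGeneralizedDerivation T δ ∧ Continuous T := fun T hT => by
    have hTa : ∀ a, T a = δ a + T 1 * a := fun a => LinearMap.congr_fun hT a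
    refine ⟨fun a b => ?_, ?_⟩
    · simp only [LinearMap.id_apply]
      rw [hTa (a * b), hTa a, hδ a b, add_mul, mul_assoc]
      abel
    · have : (T : A → A) = fun a => δ a + T 1 * a := funext hTa
      rw [this]
      exact hδ.continuous.add (continuous_const.mul continuous_id)
  exact ⟨⟨δ, hδ, eD, eE, eH, (hgen D eD).1, (hgen E eE).1, (hgen H eH).1⟩,
    (hgen D eD).2, (hgen E eE).2, (hgen H eH).2⟩
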